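/- Consider metric uncapacitated Facility Location with a finite set $F$ of facilities, a finite set $C$ of clients, a (pseudo)metric $dist$ on $F\cup C$ and opening costs $open(f)\ge 0$. For a solution $S\subseteq F$ (nonempty whenever $C\neq\emptyset$) let $open(S)=\sum_{f\in S}open(f)$, $dist(c,S)=\min_{f\in S}dist(c,f)$, $d(S)=\sum_{c\in C}dist(c,S)$ and $cost(S)=open(S)+d(S)$. Each client $c$ is served in $S$ by a facility $S(c)\in S$ with $dist(c,S(c))=dist(c,S)$ (ties broken arbitrarily); $C_S(f)$ is the set of clients served by $f$ in $S$. **JMS.** Initially all clients are active, no facility is open and $\alpha_c=0$ for all $c\in C$. The offer of a client $c$ to a closed facility $f$ is $\max\{0,\alpha_c-dist(c,f)\}$ if $c$ is active, and $\max\{0,dist(c,g)-dist(c,f)\}$ if $c$ is currently connected to $g$. The $\alpha_c$ of all active clients are raised at uniform rate until one of the following happens: (i) $\alpha_c=dist(c,f)$ for an active $c$ and an open $f$; then $c$ is connected to $f$ and becomes inactive; (ii) the total offer to a closed facility $f$ reaches $open(f)$; then $f$ is opened and every client making a strictly positive offer to $f$ is connected to $f$ (and is inactive). This is repeated until no client is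 active, and the set of open facilities is returned. Simultaneous events are handled in an arbitrary order, fixed by the implementation. Extend-JMS$(X)$ runs JMS on the instance in which the opening cost of every $f\in X$ is changed to $0$, and returns the resulting set of open facilities. **Local optimum.** Let $\varepsilon>0$. A solution $S'$ is a local optimum of LocalSearch-JMS if $cost(S')\le cost(S'')$ (with the original opening costs) both for every solution $S''$ with $|S''\setminus S'|+|S'\setminus S''|\le 1/\varepsilon+1$, and for every $S''=$ Extend-JMS$((S'\setminus\{f\})\cup\{f'\})$ with $f\in S'$ and $f'\in F\setminus S'$. **Matching.** Let $0<\delta\le 1/2$ and let $OPT$ be an arbitrary solution. Facilities $f'\in S'$ and $f^*\in OPT$ are matched if $$|C_{S'}(f')\cap C_{OPT}(f^*)|>(1-\delta)\,|C_{OPT}(f^*)|\quad\text{and}\quad |C_{S'}(f')\cap C_{OPT}(f^*)|>\tfrac12\,|C_{S'}(f')|.$$ Let $OPT^M$ be the set of facilities of $OPT$ that are matched to some facility of $S'$, and let $OPT^L=OPT\setminus OPT^M$ be the set of lonely ones. Let $opt^M$ and $opt^L$ be the total connection costs in $OPT$ of the clients served in $OPT$ by a facility of $OPT^M$ and of $OPT^L$,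 respectively. Let $opt=d(OPT)$ and $d'=d(S')$. **Theorem.** There is an absolute constant $K$ such that for all instances, all $\varepsilon>0$, all $0<\delta\le1/2$, every implementation of JMS, every local optimum $S'$ of LocalSearch-JMS and every solution $OPT$, $$open(S')+d'\;\le\; open(OPT)+\frac{\delta}{1-\delta}\,d'+\frac{1}{1-\delta}\,opt^M+4\,opt^L+K\,\varepsilon\,(d'+opt).$$ -/

import Mathlib

/-- An instance of metric uncapacitated facility location with facilities `F` and clients `C`:
a metric on the disjoint union of `F` and `C` (distinct points may be co-located) and
non-negative opening costs. -/
structure FacilityLocation (F C : Type*) where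
  metric : PseudoMetricSpace (F ⊕ C)
  opening : F → ℝ
  opening_nonneg : ∀ f, 0 ≤ opening f

namespace FacilityLocation

variable {F C : Type*}

/-- The distance between a facility and a client. -/
def d (I : FacilityLocation F C) (f : F) (c : C) : ℝ :=
  I.metric.dist (Sum.inl f) (Sum.inr c)

/-- `dist(c, S)`, the minimum of `dist(c, f)` over `f ∈ S` (only used for nonempty `S`). -/
noncomputable def distTo (I : FacilityLocation F C) (S : Finset F) (c : C) : ℝ :=
  if h : S.Nonempty then S.inf' h (fun f => I.d f c) else 0

/-- The opening cost of a set of facilities. -/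
def openCost (I : FacilityLocation F C) (S : Finset F) : ℝ :=
  ∑ f ∈ S, I.opening f

/-- The connection cost of a set of open facilities. -/
noncomputable def connCost (I : FacilityLocation F C) [Fintype C] (S : Finset F) : ℝ :=
  ∑ c, I.distTo S c

/-- The total cost of a set of open facilities. -/
noncomputable def cost (I : FacilityLocation F C) [Fintype C] (S : Finset F) : ℝ :=
  I.openCost S + I.connCost S

/-- A set of open facilities is a feasible solution if every client can be served; that is, it is
nonempty as soon as there is a client. -/
def IsSolution (_I : FacilityLocation F C) (S : Finset F) : Prop :=
  Nonempty C → S.Nonempty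

/-- `σ` assigns to each client a closest open facility (ties are broken arbitrarily); `σ c` is the
facility serving `c` in the solution `S`. -/
def IsServing (I : FacilityLocation F C) (S : Finset F) (σ : C → F) : Prop :=
  ∀ c, σ c ∈ S ∧ I.d (σ c) c = I.distTo S c

/-! ### The JMS algorithm -/

/-- A state of the JMS algorithm: the dual variables, the set of open facilities, and for each
inactive client the facility it is connected to (`none` for the active clients). -/
structure JMSState (F C : Type*) where
  alpha : C → ℝ
  opened : Finset F
  conn : C → Option F

/-- Initially all dual variables are `0`, no facility is open and all clients are active. -/
def JMSState.start : JMSState F C where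
  alpha := fun _ => 0
  opened := ∅
  conn := fun _ => none

/-- Increase the dual variables of all the active clients by `θ`. -/
def JMSState.raise (s : JMSState F C) (θ : ℝ) : JMSState F C where
  alpha := fun j => if s.conn j = none then s.alpha j + θ else s.alpha j
  opened := s.opened
  conn := s.conn

/-- The offer of client `j` to the closed facility `f`. -/
noncomputable def offer (I : FacilityLocation F C) (s : JMSState F C) (j : C) (f : F) : ℝ :=
  match s.conn j with
  | none => max 0 (s.alpha j - I.d f j)
  | some g => max 0 (I.d g j - I.d f j)

/-- The active client `j` reaches the open facility `f`. -/
def ConnectEvent (I : FacilityLocation F C) (s : JMSState F C) (j : C) (f : F) : Prop :=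
  s.conn j = none ∧ f ∈ s.opened ∧ s.alpha j = I.d f j

/-- The offers to the closed facility `f` reach its opening cost. -/
def OpenEvent (I : FacilityLocation F C) [Fintype C] (s : JMSState F C) (f : F) : Prop :=
  f ∉ s.opened ∧ I.opening f ≤ ∑ j, I.offer s j f

/-- Connect client `j` to the open facility `f`. -/
def JMSState.connect [DecidableEq C] (s : JMSState F C) (j : C) (f : F) : JMSState F C where
  alpha := s.alpha
  opened := s.opened
  conn := Function.update s.conn j (some f)

/-- Open facility `f` and connect to it all the clients that make it a strictly positive offer. -/
noncomputable def openFacility [DecidableEq F] (I : FacilityLocation F C) (s : JMSState F C) (f : F) :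
    JMSState F C where
  alpha := s.alpha
  opened := insert f s.opened
  conn := fun j => if 0 < I.offer s j f then some f else s.conn j

/-- One step of the JMS algorithm, performed as long as some client is active: raise the dual
variables of the active clients up to a moment before which no event is possible, or handle one of
the currently possible events. Simultaneous events may be handled in any order. -/
inductive JMSStep (I : FacilityLocation F C) [Fintype C] [DecidableEq F]
    [DecidableEq C] : JMSState F C → JMSState F C → Prop
  | raise (s : JMSState F C) (θ : ℝ) (hact : ∃ j, s.conn j = none) (hθ : 0 < θ)
      (hconn : ∀ η, 0 ≤ η → η < θ → ∀ j f, ¬ I.ConnectEvent (s.raise η) j f)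
      (hopen : ∀ η, 0 ≤ η → η < θ → ∀ f, ¬ I.OpenEvent (s.raise η) f) :
      JMSStep I s (s.raise θ)
  | connect (s : JMSState F C) (j : C) (f : F) (h : I.ConnectEvent s j f) :
      JMSStep I s (s.connect j f)
  | openFacility (s : JMSState F C) (f : F) (hact : ∃ j, s.conn j = none) (h : I.OpenEvent s f) :
      JMSStep I s (I.openFacility s f)

/-- `S` is the set of open facilities returned by some run of JMS on `I`: the run stops as soon as
no client is active. -/
def IsJMSOutput (I : FacilityLocation F C) [Fintype C] [DecidableEq F] [DecidableEq C]
    (S : Finset F) : Prop :=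
  ∃ s : JMSState F C, Relation.ReflTransGen I.JMSStep JMSState.start s ∧
    (∀ j, s.conn j ≠ none) ∧ s.opened = S

/-- `jms` is an implementation of the JMS algorithm, i.e. JMS with some fixed (arbitrary) rule for
the order in which simultaneous events are handled. -/
def IsJMSAlgorithm [Fintype C] [DecidableEq F] [DecidableEq C]
    (jms : FacilityLocation F C → Finset F) : Prop :=
  ∀ I : FacilityLocation F C, I.IsJMSOutput (jms I)

/-- The instance in which the facilities in `X` have opening cost `0`. -/
def zeroOn [DecidableEq F] (I : FacilityLocation F C) (X : Finset F) : FacilityLocation F C where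
  metric := I.metric
  opening := fun f => if f ∈ X then 0 else I.opening f
  opening_nonneg := fun f => by
    split_ifs
    · exact le_rfl
    · exact I.opening_nonneg f

/-- `Extend-JMS(X)`: run JMS after setting the opening costs of the facilities in `X` to `0`. -/
def extendJMS [DecidableEq F] (jms : FacilityLocation F C → Finset F) (I : FacilityLocation F C)
    (X : Finset F) : Finset F :=
  jms (I.zeroOn X)

/-- `S` is a local optimum of `LocalSearch-JMS` with parameter `ε`: no swap of at most `1/ε + 1`
facilities, and no move which replaces `S` by `Extend-JMS(S - {f} ∪ {f'})` with `f ∈ S` and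
`f' ∉ S`, strictly decreases the total cost (with respect to the original opening costs). -/
structure IsLocalOptimum [Fintype C] [DecidableEq F] (jms : FacilityLocation F C → Finset F)
    (I : FacilityLocation F C) (ε : ℝ) (S : Finset F) : Prop where
  isSolution : I.IsSolution S
  swap : ∀ T : Finset F, I.IsSolution T →
    ((T \ S).card : ℝ) + ((S \ T).card : ℝ) ≤ 1 / ε + 1 → I.cost S ≤ I.cost T
  extend : ∀ f ∈ S, ∀ f' ∉ S, I.cost S ≤ I.cost (extendJMS jms I (insert f' (S.erase f)))

/-! ### Matched and lonely facilities -/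

/-- For solutions with assignments `σ` and `τ`: facility `f` of the first solution `a`-captures
facility `g` of the second one, i.e. more than an `a` fraction of the clients served by `g` in the
second solution are served by `f` in the first. -/
def Captures [Fintype C] [DecidableEq F] (a : ℝ) (σ τ : C → F) (f g : F) : Prop :=
  a * ((Finset.univ.filter fun c => τ c = g).card : ℝ) <
    ((Finset.univ.filter fun c => σ c = f ∧ τ c = g).card : ℝ)

/-- `f` (in the solution with assignment `σ`) and `g` (in the solution with assignment `τ`) are
matched with parameters `δ₁` and `δ₂`. -/
def Matched [Fintype C] [DecidableEq F] (δ₁ δ₂ : ℝ) (σ τ : C → F) (f g : F) : Prop :=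
  Captures (1 - δ₁) σ τ f g ∧ Captures (1 - δ₂) τ σ g f

open Classical in
/-- The facilities of `T` (with assignment `τ`) that are matched to a facility of `S`
(with assignment `σ`). -/
noncomputable def matchedPart [Fintype C] [DecidableEq F] (δ₁ δ₂ : ℝ) (S T : Finset F)
    (σ τ : C → F) : Finset F :=
  T.filter fun g => ∃ f ∈ S, Matched δ₁ δ₂ σ τ f g

/-- The facilities of `T` that are lonely, i.e. not matched. -/
noncomputable def lonelyPart [Fintype C] [DecidableEq F] (δ₁ δ₂ : ℝ) (S T : Finset F)
    (σ τ : C → F) : Finset F :=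
  T \ matchedPart δ₁ δ₂ S T σ τ

/-- The total connection cost, under the assignment `τ`, of the clients served by `G`. -/
def servedCost [Fintype C] [DecidableEq F] (I : FacilityLocation F C) (τ : C → F)
    (G : Finset F) : ℝ :=
  ∑ c ∈ Finset.univ.filter (fun c => τ c ∈ G), I.d (τ c) c

end FacilityLocation

/-!
The proof compares a local optimum `S` with a solution `T` by closing each facility `f` of `S` once
and opening each facility `g` of `T` once, namely when `π g` is closed: `π g` is the partner of `g`
if `g` is matched, and a facility of `S` nearest to `g` if `g` is lonely
(`FacilityLocation.exists_assignment`).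

When `f` is closed, one facility `g₁` with `π g₁ = f` is swapped in and `Extend-JMS` is run on `X =
S - f + g₁`. The set `W` of the other lonely facilities `g` with `π g = f` may be large, and JMS
pays for it: by `FacilityLocation.cost_extendJMS_le`, the cost of the result is at most that of `X ∪
W`, where clients using `W` pay twice their distance to it and all others pay their distance to `X`
once. (If all these `g` are in `S` already, `f` is just dropped; if `f` itself is one of them, it
stays open and the others are added one by one.) The bound for `Extend-JMS` follows from dual
fitting. The dual variables `α` pay for the output (`FacilityLocation.JMSInvariant`); no `α` exceeds
the distance to a free facility; and the dual variables of any set `N` of clients sum to at most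
`opening g + 2 * ∑ c ∈ N, d g c` for every facility `g`. For the last bound, the offers to `g` at
each of the moments when a client of `N` becomes inactive sum to at most `opening g`, and the
triangle inequality bounds these offers from below in terms of `α`; averaging over the moments gives
the claim (`FacilityLocation.OfferHistory.sum_alpha_le`).

Summing over `f` (`FacilityLocation.IsLocalOptimum.opening_le`), every client `c` is involved at
most twice: when `π (τ c)` is closed, and when its facility `σ c` is closed and it moves to
`π (τ c)`. If `τ c` is lonely, the two changes add up to at most `4 * d (τ c) c - d (σ c) c`
(`FacilityLocation.openChange_add_closeChange_le`). If `τ c` is matched, only the less than `δ`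
fraction of its clients that its partner does not serve are moved, and their detour is charged to
the other clients of `τ c` (`FacilityLocation.sum_change_le_of_captures`).
-/

namespace FacilityLocation

variable {F C : Type*}

/-! ### Distances and costs -/

theorem d_nonneg (I : FacilityLocation F C) (f : F) (c : C) : 0 ≤ I.d f c :=
  @dist_nonneg _ I.metric _ _

/-- The distance between two facilities. -/
def facDist (I : FacilityLocation F C) (f g : F) : ℝ :=
  I.metric.dist (Sum.inl f) (Sum.inl g)

theorem facDist_le (I : FacilityLocation F C) (f g : F) (c : C) :
    I.facDist f g ≤ I.d f c + I.d g c :=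
  @dist_triangle_right _ I.metric _ _ _

theorem d_le_facDist_add (I : FacilityLocation F C) (f g : F) (c : C) :
    I.d f c ≤ I.facDist f g + I.d g c :=
  @dist_triangle _ I.metric _ _ _

theorem d_le_three (I : FacilityLocation F C) (f g : F) (i j : C) :
    I.d f i ≤ I.d f j + I.d g j + I.d g i :=
  (I.d_le_facDist_add f g i).trans (by linarith [I.facDist_le f g j])

theorem distTo_le (I : FacilityLocation F C) {S : Finset F} {f : F} (hf : f ∈ S) (c : C) :
    I.distTo S c ≤ I.d f c := by
  unfold distTo
  rw [dif_pos ⟨f, hf⟩]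
  exact Finset.inf'_le _ hf

theorem cost_le_of_assignment (I : FacilityLocation F C) [Fintype C] {S : Finset F} (ρ : C → F)
    (hρ : ∀ c, ρ c ∈ S) : I.cost S ≤ I.openCost S + ∑ c, I.d (ρ c) c :=
  add_le_add le_rfl (Finset.sum_le_sum fun c _ => I.distTo_le (hρ c) c)

theorem connCost_eq_sum (I : FacilityLocation F C) [Fintype C] {S : Finset F} {σ : C → F}
    (hσ : I.IsServing S σ) : I.connCost S = ∑ c, I.d (σ c) c :=
  Finset.sum_congr rfl fun c _ => (hσ c).2.symm

theorem IsServing.le {I : FacilityLocation F C} {S : Finset F} {σ : C → F}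
    (hσ : I.IsServing S σ) {f : F} (hf : f ∈ S) (c : C) : I.d (σ c) c ≤ I.d f c :=
  (hσ c).2.trans_le (I.distTo_le hf c)

/-! ### Invariants of the JMS algorithm -/

/-- The distance up to which client `j` bids in state `s`: its dual variable while it is active,
and its current connection cost afterwards. -/
noncomputable def reach (I : FacilityLocation F C) (s : JMSState F C) (j : C) : ℝ :=
  (s.conn j).elim (s.alpha j) fun g => I.d g j

theorem offer_eq (I : FacilityLocation F C) (s : JMSState F C) (j : C) (f : F) :
    I.offer s j f = max 0 (I.reach s j - I.d f j) := by
  unfold offer reach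
  cases s.conn j <;> rfl

theorem offer_nonneg (I : FacilityLocation F C) (s : JMSState F C) (j : C) (f : F) :
    0 ≤ I.offer s j f := by
  rw [offer_eq]; exact le_max_left _ _

/-- What is left of the dual variable of an inactive client after paying for its connection. -/
noncomputable def surplus (I : FacilityLocation F C) (s : JMSState F C) (j : C) : ℝ :=
  (s.conn j).elim 0 fun g => s.alpha j - I.d g j

/-- Properties that hold throughout a run of JMS. In particular, no dual variable exceeds the
distance to a free facility, as free facilities are opened before the first raise, and the dual
variables of the inactive clients pay for the open facilities and the connections. -/
structure JMSInvariant (I : FacilityLocation F C) [Fintype C] (s : JMSState F C) : Prop where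
  conn_mem : ∀ j f, s.conn j = some f → f ∈ s.opened
  alpha_eq : ∀ i j, s.conn i = none → s.conn j = none → s.alpha i = s.alpha j
  active_le : ∀ j, s.conn j = none → ∀ f ∈ s.opened, s.alpha j ≤ I.d f j
  free_le : ∀ f, I.opening f = 0 → ∀ j, s.alpha j ≤ I.d f j
  offers_le : ∀ f ∉ s.opened, ∑ j, I.offer s j f ≤ I.opening f
  budget : I.openCost s.opened ≤ ∑ j, I.surplus s j

theorem JMSInvariant.start (I : FacilityLocation F C) [Fintype C] :
    I.JMSInvariant JMSState.start where
  conn_mem j f h := by simp [JMSState.start] at h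
  alpha_eq _ _ _ _ := rfl
  active_le j _ f h := by simp [JMSState.start] at h
  free_le f _ j := I.d_nonneg f j
  offers_le f _ := by
    refine (Finset.sum_eq_zero fun j _ => ?_).trans_le (I.opening_nonneg f)
    rw [offer_eq]
    simpa [reach, JMSState.start] using I.d_nonneg f j
  budget := by simp [openCost, surplus, JMSState.start]

theorem JMSInvariant.raise {I : FacilityLocation F C} [Fintype C] {s : JMSState F C}
    (h : I.JMSInvariant s) {θ : ℝ} (hθ : 0 < θ)
    (hconn : ∀ η, 0 ≤ η → η < θ → ∀ j f, ¬ I.ConnectEvent (s.raise η) j f)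
    (hopen : ∀ η, 0 ≤ η → η < θ → ∀ f, ¬ I.OpenEvent (s.raise η) f) :
    I.JMSInvariant (s.raise θ) := by
  have hact : ∀ j, s.conn j = none → ∀ f ∈ s.opened, s.alpha j + θ ≤ I.d f j := by
    intro j hj f hf
    by_contra! hlt
    have := h.active_le j hj f hf
    refine hconn (I.d f j - s.alpha j) (by linarith) (by linarith) j f ⟨hj, hf, ?_⟩
    simp [JMSState.raise, hj]
  refine ⟨h.conn_mem, fun i j hi hj => ?_, fun j hj f hf => ?_, fun f hf j => ?_,
    fun f hf => ?_, ?_⟩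
  · have hi' : s.conn i = none := hi
    have hj' : s.conn j = none := hj
    simp [JMSState.raise, hi', hj', h.alpha_eq i j hi' hj']
  · have hj' : s.conn j = none := hj
    simpa [JMSState.raise, hj'] using hact j hj' f hf
  · -- A free facility is open whenever the dual variables are raised.
    have hfo : f ∈ s.opened := by
      by_contra hfo
      exact hopen 0 le_rfl hθ f ⟨hfo, by
        rw [hf]; exact Finset.sum_nonneg fun j _ => I.offer_nonneg _ j f⟩
    by_cases hj : s.conn j = none
    · simpa [JMSState.raise, hj] using hact j hj f hfo
    · simpa [JMSState.raise, hj] using h.free_le f hf j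
  · -- The offers are continuous in the raise and stay below the opening cost before its end.
    have hreach : ∀ η j, I.reach (s.raise η) j
        = I.reach s j + (if s.conn j = none then η else 0) := by
      intro η j
      cases hj : s.conn j <;> simp [reach, JMSState.raise, hj]
    have hcont : Continuous fun η => ∑ j, I.offer (s.raise η) j f := by
      simp_rw [offer_eq, hreach]
      refine continuous_finsetSum _ fun j _ => ?_
      split_ifs <;> fun_prop
    refine le_of_tendsto ((hcont.tendsto θ).mono_left nhdsWithin_le_nhds)
      (Filter.mem_of_superset (Ioo_mem_nhdsLT hθ) fun η hη => ?_)
    by_contra hlt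
    exact hopen η hη.1.le hη.2 f ⟨hf, (not_le.1 hlt).le⟩
  · have : ∀ j, I.surplus (s.raise θ) j = I.surplus s j := by
      intro j
      cases hj : s.conn j <;> simp [surplus, JMSState.raise, hj]
    simp only [this]
    exact h.budget

theorem JMSInvariant.connect {I : FacilityLocation F C} [Fintype C] [DecidableEq C]
    {s : JMSState F C} (h : I.JMSInvariant s) {i : C} {f : F} (he : I.ConnectEvent s i f) :
    I.JMSInvariant (s.connect i f) := by
  obtain ⟨hi, hf, hα⟩ := he
  have hnone : ∀ j, (s.connect i f).conn j = none → s.conn j = none := by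
    intro j hj
    by_cases hij : j = i
    · exact hij ▸ hi
    · simpa [JMSState.connect, hij] using hj
  have hreach : ∀ j, I.reach (s.connect i f) j = I.reach s j := by
    intro j
    by_cases hij : j = i
    · subst hij; simp [reach, JMSState.connect, hi, hα]
    · simp [reach, JMSState.connect, hij]
  have hsurplus : ∀ j, I.surplus (s.connect i f) j = I.surplus s j := by
    intro j
    by_cases hij : j = i
    · subst hij; simp [surplus, JMSState.connect, hi, hα]
    · simp [surplus, JMSState.connect, hij]
  refine ⟨fun j g hj => ?_, fun j k hj hk => h.alpha_eq j k (hnone j hj) (hnone k hk),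
    fun j hj => h.active_le j (hnone j hj), h.free_le, fun g hg => ?_, ?_⟩
  · by_cases hij : j = i
    · subst hij
      have : f = g := by simpa [JMSState.connect] using hj
      exact this ▸ hf
    · exact h.conn_mem j g (by simpa [JMSState.connect, hij] using hj)
  · simp_rw [offer_eq, hreach, ← offer_eq]
    exact h.offers_le g hg
  · simp only [hsurplus]
    exact h.budget

theorem JMSInvariant.openFacility {I : FacilityLocation F C} [Fintype C] [DecidableEq F]
    [DecidableEq C] {s : JMSState F C} (h : I.JMSInvariant s) {f : F} (he : I.OpenEvent s f) :
    I.JMSInvariant (I.openFacility s f) := by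
  obtain ⟨hf, hoff⟩ := he
  have hpos : ∀ j, 0 < I.offer s j f → (I.openFacility s f).conn j = some f :=
    fun j hj => if_pos hj
  have hneg : ∀ j, ¬ 0 < I.offer s j f → (I.openFacility s f).conn j = s.conn j :=
    fun j hj => if_neg hj
  have hnone : ∀ j, (I.openFacility s f).conn j = none →
      s.conn j = none ∧ ¬ 0 < I.offer s j f := by
    intro j hj
    by_cases hp : 0 < I.offer s j f
    · simp [hpos j hp] at hj
    · exact ⟨hneg j hp ▸ hj, hp⟩
  have hreach : ∀ j, I.reach (I.openFacility s f) j ≤ I.reach s j := by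
    intro j
    by_cases hp : 0 < I.offer s j f
    · have : I.reach (I.openFacility s f) j = I.d f j := by simp [reach, hpos j hp]
      rw [offer_eq, lt_max_iff] at hp
      rcases hp with hp | hp
      · exact absurd hp (lt_irrefl _)
      · linarith
    · unfold reach
      rw [hneg j hp]
      rfl
  have hsurplus : ∀ j, I.surplus (I.openFacility s f) j = I.surplus s j + I.offer s j f := by
    intro j
    by_cases hp : 0 < I.offer s j f
    · have h1 : I.surplus (I.openFacility s f) j = s.alpha j - I.d f j := by
        unfold surplus
        rw [hpos j hp]
        rfl
      have h2 : I.offer s j f = I.reach s j - I.d f j := by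
        rw [offer_eq] at hp ⊢
        exact max_eq_right (by
          rcases lt_max_iff.1 hp with hp | hp
          · exact absurd hp (lt_irrefl _)
          · exact hp.le)
      rw [h1, h2]
      cases hj : s.conn j <;> simp [surplus, reach, hj]
    · have h0 : I.offer s j f = 0 := le_antisymm (not_lt.1 hp) (I.offer_nonneg s j f)
      rw [h0, add_zero]
      unfold surplus
      rw [hneg j hp]
      rfl
  refine ⟨fun j g hj => ?_,
    fun i j hi hj => h.alpha_eq i j (hnone i hi).1 (hnone j hj).1, fun j hj g hg => ?_, h.free_le,
    fun g hg => ?_, ?_⟩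
  · by_cases hp : 0 < I.offer s j f
    · have : f = g := by simpa [hpos j hp] using hj
      exact this ▸ Finset.mem_insert_self _ _
    · rw [hneg j hp] at hj
      exact Finset.mem_insert_of_mem (h.conn_mem j g hj)
  · obtain ⟨hjs, hp⟩ := hnone j hj
    have hr : I.reach s j = s.alpha j := by simp [reach, hjs]
    rcases Finset.mem_insert.1 hg with rfl | hg
    · rw [offer_eq, lt_max_iff, not_or] at hp
      have := hp.2
      change s.alpha j ≤ _
      linarith
    · exact h.active_le j hjs g hg
  · refine le_trans (Finset.sum_le_sum fun j _ => ?_)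
      (h.offers_le g fun hgs => hg (Finset.mem_insert_of_mem hgs))
    rw [offer_eq, offer_eq]
    exact max_le_max le_rfl (sub_le_sub_right (hreach j) _)
  · have : I.openCost (I.openFacility s f).opened = I.opening f + I.openCost s.opened :=
      Finset.sum_insert hf
    rw [this]
    simp_rw [hsurplus, Finset.sum_add_distrib]
    linarith [h.budget]

theorem JMSInvariant.step {I : FacilityLocation F C} [Fintype C] [DecidableEq F]
    [DecidableEq C] {s t : JMSState F C} (h : I.JMSInvariant s) (hst : I.JMSStep s t) :
    I.JMSInvariant t := by
  cases hst with
  | raise θ hact hθ hconn hopen => exact h.raise hθ hconn hopen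
  | connect j f he => exact h.connect he
  | openFacility f hact he => exact h.openFacility he

/-! ### The dual solution is feasible up to a factor of two in the distances -/

/-- The history of the offers to `g`, kept for the set `G` of clients that became inactive while
`g` was closed: `o i j` is the offer of `j` to `g` at the moment when `i` became inactive.
The last field holds because of two clients of `G`, the one that becomes inactive later can
reach `g` through the facility serving the other one. -/
structure OfferHistory (I : FacilityLocation F C) [Fintype C] (g : F) (s : JMSState F C)
    (G : Finset C) (o : C → C → ℝ) : Prop where
  inactive : ∀ i ∈ G, s.conn i ≠ none
  le_of_notMem : ∀ i, s.conn i ≠ none → i ∉ G → s.alpha i ≤ I.d g i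
  nonneg : ∀ i ∈ G, ∀ j, 0 ≤ o i j
  sum_le : ∀ i ∈ G, ∑ j, o i j ≤ I.opening g
  le_active : ∀ i ∈ G, ∀ j, s.conn j = none → s.alpha i - I.d g j ≤ o i j
  le_pair : ∀ i ∈ G, ∀ j ∈ G,
    s.alpha i + s.alpha j - 2 * I.d g i - 2 * I.d g j ≤ o i j + o j i

theorem OfferHistory.raise {I : FacilityLocation F C} [Fintype C] {g : F} {s : JMSState F C}
    {G : Finset C} {o : C → C → ℝ} (h : I.OfferHistory g s G o) (θ : ℝ) :
    I.OfferHistory g (s.raise θ) G o := by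
  have hα : ∀ i, s.conn i ≠ none → (s.raise θ).alpha i = s.alpha i := fun i hi => if_neg hi
  refine ⟨h.inactive, fun i hi hiG => ?_, h.nonneg, h.sum_le, fun i hi j hj => ?_,
    fun i hi j hj => ?_⟩
  · rw [hα i hi]; exact h.le_of_notMem i hi hiG
  · rw [hα i (h.inactive i hi)]; exact h.le_active i hi j hj
  · rw [hα i (h.inactive i hi), hα j (h.inactive j hj)]; exact h.le_pair i hi j hj

/-- Whatever the event, the history can be continued when some active clients get connected. -/
theorem OfferHistory.deactivate {I : FacilityLocation F C} [Fintype C] {g : F}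
    {s t : JMSState F C} (hs : I.JMSInvariant s) (hα : t.alpha = s.alpha)
    (hconn : ∀ j, t.conn j = none → s.conn j = none)
    {G : Finset C} {o : C → C → ℝ} (h : I.OfferHistory g s G o) :
    ∃ G' o', I.OfferHistory g t G' o' := by
  classical
  by_cases hg : g ∈ s.opened
  · refine ⟨G, o, fun i hi hit => h.inactive i hi (hconn i hit), fun i hi hiG => ?_, h.nonneg,
      h.sum_le, fun i hi j hj => hα ▸ h.le_active i hi j (hconn j hj), hα ▸ h.le_pair⟩
    rw [hα]
    by_cases his : s.conn i = none
    · exact hs.active_le i his g hg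
    · exact h.le_of_notMem i his hiG
  · have hact : ∀ j, s.conn j = none → s.alpha j - I.d g j ≤ I.offer s j g := by
      intro j hj
      have : I.reach s j = s.alpha j := by simp [reach, hj]
      rw [offer_eq, this]
      exact le_max_right _ _
    -- An active client can reach `g` through the facility of an inactive one.
    have hmix : ∀ i j, s.conn i = none → s.conn j ≠ none →
        s.alpha i - I.d g i - 2 * I.d g j ≤ I.offer s j g := by
      intro i j hi hj
      obtain ⟨f, hf⟩ := Option.ne_none_iff_exists'.1 hj
      have h1 := hs.active_le i hi f (hs.conn_mem j f hf)
      have h2 := I.d_le_three f g i j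
      have h3 : I.reach s j = I.d f j := by simp [reach, hf]
      rw [offer_eq, h3]
      exact le_trans (by linarith) (le_max_right _ _)
    refine ⟨Finset.univ.filter fun i => t.conn i ≠ none ∧ (i ∈ G ∨ s.conn i = none),
      fun i j => if s.conn i = none then I.offer s j g else o i j, fun i hi => ?_,
      fun i hi hiG => ?_, fun i hi j => ?_, fun i hi => ?_, fun i hi j hj => ?_,
      fun i hi j hj => ?_⟩
    · exact (Finset.mem_filter.1 hi).2.1
    · simp only [Finset.mem_filter, Finset.mem_univ, true_and, not_and, not_or] at hiG
      rw [hα]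
      exact h.le_of_notMem i (hiG hi).2 (hiG hi).1
    · split_ifs with his
      · exact I.offer_nonneg s j g
      · exact h.nonneg i ((Finset.mem_filter.1 hi).2.2.resolve_right his) j
    · by_cases his : s.conn i = none
      · simpa only [his, if_true] using hs.offers_le g hg
      · simpa only [his, if_false] using
          h.sum_le i ((Finset.mem_filter.1 hi).2.2.resolve_right his)
    · rw [hα]
      split_ifs with his
      · rw [hs.alpha_eq i j his (hconn j hj)]
        exact hact j (hconn j hj)
      · exact h.le_active i ((Finset.mem_filter.1 hi).2.2.resolve_right his) j (hconn j hj)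
    · have hi' := (Finset.mem_filter.1 hi).2.2
      have hj' := (Finset.mem_filter.1 hj).2.2
      have hdi := I.d_nonneg g i
      have hdj := I.d_nonneg g j
      rw [hα]
      by_cases his : s.conn i = none <;> by_cases hjs : s.conn j = none <;>
        simp only [his, hjs, if_true, if_false]
      · have := hact i his
        have := hact j hjs
        linarith
      · have := hmix i j his hjs
        have := h.le_active j (hj'.resolve_right hjs) i his
        linarith
      · have := hmix j i hjs his
        have := h.le_active i (hi'.resolve_right his) j hjs
        linarith
      · exact h.le_pair i (hi'.resolve_right his) j (hj'.resolve_right hjs)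

theorem OfferHistory.step {I : FacilityLocation F C} [Fintype C] [DecidableEq F]
    [DecidableEq C] {g : F} {s t : JMSState F C} (hs : I.JMSInvariant s) (hst : I.JMSStep s t)
    (h : ∃ G o, I.OfferHistory g s G o) : ∃ G o, I.OfferHistory g t G o := by
  obtain ⟨G, o, h⟩ := h
  cases hst with
  | raise θ hact hθ hconn hopen => exact ⟨G, o, h.raise θ⟩
  | connect i f he =>
    refine h.deactivate hs rfl fun j hj => ?_
    by_cases hij : j = i
    · exact hij ▸ he.1
    · simpa [JMSState.connect, hij] using hj
  | openFacility f hact he =>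
    refine h.deactivate hs rfl fun j hj => ?_
    by_contra hne
    change (if 0 < I.offer s j f then some f else s.conn j) = none at hj
    split_ifs at hj
    exact hne hj

/-- Averaging the budgets of `g` at the moments when its clients became inactive bounds the sum
of the dual variables. -/
theorem OfferHistory.sum_alpha_le {I : FacilityLocation F C} [Fintype C] {g : F}
    {s : JMSState F C} (hconn : ∀ j, s.conn j ≠ none) {G : Finset C} {o : C → C → ℝ}
    (h : I.OfferHistory g s G o) (N : Finset C) :
    ∑ j ∈ N, s.alpha j ≤ I.opening g + 2 * ∑ j ∈ N, I.d g j := by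
  classical
  set A := N.filter (· ∈ G) with hA
  have hsub : ∀ i ∈ A, i ∈ G := fun i hi => (Finset.mem_filter.1 hi).2
  have hbad : ∑ j ∈ N.filter (· ∉ G), s.alpha j ≤ 2 * ∑ j ∈ N.filter (· ∉ G), I.d g j := by
    rw [Finset.mul_sum]
    refine Finset.sum_le_sum fun j hj => ?_
    have := h.le_of_notMem j (hconn j) (Finset.mem_filter.1 hj).2
    linarith [I.d_nonneg g j]
  have hgood : ∑ j ∈ A, s.alpha j ≤ I.opening g + 2 * ∑ j ∈ A, I.d g j := by
    rcases A.eq_empty_or_nonempty with hE | hne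
    · simpa [hE] using I.opening_nonneg g
    have h1 : ∑ i ∈ A, ∑ j ∈ A, o i j ≤ A.card * I.opening g := by
      rw [← nsmul_eq_mul]
      refine Finset.sum_le_card_nsmul _ _ _ fun i hi => ?_
      exact (Finset.sum_le_univ_sum_of_nonneg (h.nonneg i (hsub i hi))).trans
        (h.sum_le i (hsub i hi))
    have h2 : ∑ i ∈ A, ∑ j ∈ A, (s.alpha i + s.alpha j - 2 * I.d g i - 2 * I.d g j)
        ≤ ∑ i ∈ A, ∑ j ∈ A, (o i j + o j i) :=
      Finset.sum_le_sum fun i hi => Finset.sum_le_sum fun j hj =>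
        h.le_pair i (hsub i hi) j (hsub j hj)
    have h3 : ∑ i ∈ A, ∑ j ∈ A, o j i = ∑ i ∈ A, ∑ j ∈ A, o i j := Finset.sum_comm
    simp only [Finset.sum_add_distrib, Finset.sum_sub_distrib, Finset.sum_const, nsmul_eq_mul,
      ← Finset.mul_sum, h3] at h2
    have hcard : (0 : ℝ) < A.card := by exact_mod_cast hne.card_pos
    refine le_of_mul_le_mul_left ?_ hcard
    linarith
  rw [← Finset.sum_filter_add_sum_filter_not N (· ∈ G) s.alpha,
    ← Finset.sum_filter_add_sum_filter_not N (· ∈ G) (I.d g)]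
  linarith

/-- The properties of the output of JMS used below, in terms of its dual variables `α`. -/
theorem IsJMSOutput.exists_dual {I : FacilityLocation F C} [Fintype C] [DecidableEq F]
    [DecidableEq C] {S : Finset F} (hS : I.IsJMSOutput S) :
    ∃ α : C → ℝ, I.cost S ≤ ∑ j, α j ∧ (∀ f, I.opening f = 0 → ∀ j, α j ≤ I.d f j) ∧
      ∀ g, ∀ N : Finset C, ∑ j ∈ N, α j ≤ I.opening g + 2 * ∑ j ∈ N, I.d g j := by
  obtain ⟨s, hs, hconn, rfl⟩ := hS
  have key : I.JMSInvariant s ∧ ∀ g, ∃ G o, I.OfferHistory g s G o := by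
    clear hconn
    induction hs with
    | refl =>
      exact ⟨JMSInvariant.start I, fun g => ⟨∅, fun _ _ => 0, by simp, fun i hi => absurd rfl hi,
        by simp, by simp, by simp, by simp⟩⟩
    | tail _ hst ih => exact ⟨ih.1.step hst, fun g => OfferHistory.step ih.1 hst (ih.2 g)⟩
  refine ⟨s.alpha, ?_, key.1.free_le, fun g N => ?_⟩
  · choose ρ hρ using fun j => Option.ne_none_iff_exists'.1 (hconn j)
    have h1 := I.cost_le_of_assignment ρ fun j => key.1.conn_mem j _ (hρ j)
    have h2 := key.1.budget
    have h3 : ∀ j, I.surplus s j = s.alpha j - I.d (ρ j) j := by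
      intro j; simp [surplus, hρ j]
    simp only [h3, Finset.sum_sub_distrib] at h2
    linarith
  · obtain ⟨G, o, h⟩ := key.2 g
    exact h.sum_alpha_le hconn N

/-- The cost of `Extend-JMS(X)` is at most that of opening `X ∪ W`, where the clients of `W` pay
twice their distance and all other clients pay their distance to `X` only once. -/
theorem cost_extendJMS_le [Fintype C] [DecidableEq F] [DecidableEq C]
    {jms : FacilityLocation F C → Finset F} (hjms : IsJMSAlgorithm jms)
    (I : FacilityLocation F C) (X W : Finset F) (τ ρ : C → F)
    (hρ : ∀ c, τ c ∉ W → ρ c ∈ X) :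
    I.cost (extendJMS jms I X) ≤ I.openCost X + I.openCost W
      + ∑ c, if τ c ∈ W then 2 * I.d (τ c) c else I.d (ρ c) c := by
  obtain ⟨α, h1, h2, h3⟩ := (hjms (I.zeroOn X)).exists_dual
  set T := extendJMS jms I X with hT
  have hopen : I.openCost T ≤ I.openCost X + (I.zeroOn X).openCost T := by
    have e1 : I.openCost T = ∑ f ∈ T, (if f ∈ X then I.opening f else 0)
        + (I.zeroOn X).openCost T := by
      unfold openCost
      rw [← Finset.sum_add_distrib]
      refine Finset.sum_congr rfl fun f _ => ?_
      by_cases hf : f ∈ X <;> simp [zeroOn, hf]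
    have e2 : ∑ f ∈ T, (if f ∈ X then I.opening f else 0) ≤ I.openCost X := by
      rw [← Finset.sum_filter]
      exact Finset.sum_le_sum_of_subset_of_nonneg
        (fun f hf => (Finset.mem_filter.1 hf).2) fun f _ _ => I.opening_nonneg f
    linarith
  have hcost : I.cost T ≤ I.openCost X + ∑ j, α j := by
    have : I.openCost X + (I.zeroOn X).cost T = I.openCost X + ((I.zeroOn X).openCost T
      + I.connCost T) := rfl
    have : I.cost T = I.openCost T + I.connCost T := rfl
    change (I.zeroOn X).cost T ≤ _ at h1
    linarith
  have hW : ∑ c ∈ Finset.univ.filter (fun c => τ c ∈ W), α c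
      ≤ I.openCost W + ∑ c ∈ Finset.univ.filter (fun c => τ c ∈ W), 2 * I.d (τ c) c := by
    rw [← Finset.sum_fiberwise_of_maps_to (t := W) (g := τ)
        (fun c hc => (Finset.mem_filter.1 hc).2),
      ← Finset.sum_fiberwise_of_maps_to (t := W) (g := τ)
        (fun c hc => (Finset.mem_filter.1 hc).2) (fun c => 2 * I.d (τ c) c)]
    unfold openCost
    rw [← Finset.sum_add_distrib]
    refine Finset.sum_le_sum fun g _ => (h3 g _).trans (add_le_add ?_ ?_)
    · by_cases hg : g ∈ X
      · simpa [zeroOn, hg] using I.opening_nonneg g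
      · simp [zeroOn, hg]
    · rw [Finset.mul_sum]
      refine Finset.sum_le_sum fun c hc => ?_
      rw [(Finset.mem_filter.1 hc).2]
      rfl
  have hX : ∑ c ∈ Finset.univ.filter (fun c => τ c ∉ W), α c
      ≤ ∑ c ∈ Finset.univ.filter (fun c => τ c ∉ W), I.d (ρ c) c :=
    Finset.sum_le_sum fun c hc =>
      h2 (ρ c) (if_pos (hρ c (Finset.mem_filter.1 hc).2)) c
  rw [Finset.sum_ite]
  have := Finset.sum_filter_add_sum_filter_not Finset.univ (fun c => τ c ∈ W) α
  linarith

/-! ### Closing one facility of a local optimum -/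

/-- The change in the cost of client `c` when the facility `π (τ c)` is closed and `τ c` is opened
in the solution with assignment `σ`. For `τ c ∈ M` only the clients of `π (τ c)` move to
`τ c`. For `τ c ∉ M` this allows for paying `2 * d (τ c) c`, as `τ c` might be opened by JMS. -/
noncomputable def openChange [DecidableEq F] (I : FacilityLocation F C) (σ τ : C → F) (π : F → F)
    (M : Finset F) (c : C) : ℝ :=
  if τ c ∈ M then (if σ c = π (τ c) then I.d (τ c) c - I.d (σ c) c else 0)
  else 2 * I.d (τ c) c - I.d (σ c) c

/-- The change in the cost of client `c` when its facility `σ c` is closed and `τ c` is not opened: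
the client moves to `π (τ c)`. There is no such change if `π (τ c) = σ c`, as then `τ c` is opened
when `σ c` is closed. -/
noncomputable def closeChange [DecidableEq F] (I : FacilityLocation F C) (σ τ : C → F) (π : F → F)
    (c : C) : ℝ :=
  if σ c = π (τ c) then 0 else I.d (π (τ c)) c - I.d (σ c) c

/-- A client of a lonely facility is charged at most `4` times its distance, since `π (τ c)` is
at least as close to `τ c` as `σ c`. -/
theorem openChange_add_closeChange_le [DecidableEq F] {I : FacilityLocation F C} {σ τ : C → F}
    {π : F → F} {M : Finset F} {c : C} (hc : τ c ∉ M)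
    (hnear : I.facDist (π (τ c)) (τ c) ≤ I.facDist (σ c) (τ c)) :
    I.openChange σ τ π M c + I.closeChange σ τ π c ≤ 4 * I.d (τ c) c - I.d (σ c) c := by
  have h1 := I.d_nonneg (τ c) c
  have h2 := I.d_le_facDist_add (π (τ c)) (τ c) c
  have h3 := I.facDist_le (σ c) (τ c) c
  unfold openChange closeChange
  rw [if_neg hc]
  split_ifs <;> linarith

section Moves

variable [Fintype C] [DecidableEq F] {I : FacilityLocation F C} {S T M : Finset F} {σ τ : C → F}
  {π : F → F}

/-- The changes of `openChange` and `closeChange` bound the effect of closing `f`, if the cost of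
`S` is at most the bound of `cost_extendJMS_le` for a suitable pair `X`, `W`. Dropping `f` is the
case `W = ∅`. -/
theorem opening_le_of_move (hσ : I.IsServing S σ) (hτ : I.IsServing T τ)
    (hπ : ∀ g ∈ T, π g ∈ S) {f : F} (hf : f ∈ S) {X W : Finset F} (hX : S.erase f ⊆ X)
    (hW : ∀ g ∈ W, π g = f ∧ g ∉ M) (hXW : ∀ g ∈ T, π g = f → g ∉ W → g ∈ X)
    (hcost : I.openCost X + I.openCost W
      ≤ I.openCost (S.erase f) + ∑ g ∈ T with π g = f, I.opening g)
    (hmove : ∀ ρ : C → F, (∀ c, τ c ∉ W → ρ c ∈ X) → I.cost S ≤ I.openCost X + I.openCost W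
      + ∑ c, if τ c ∈ W then 2 * I.d (τ c) c else I.d (ρ c) c) :
    I.opening f ≤ ∑ g ∈ T with π g = f, I.opening g
      + ∑ c, ((if π (τ c) = f then I.openChange σ τ π M c else 0)
        + if σ c = f then I.closeChange σ τ π c else 0) := by
  have hS : I.openCost (S.erase f) + I.opening f = I.openCost S := Finset.sum_erase_add _ _ hf
  set ρ : C → F := fun c =>
    if π (τ c) = f then (if τ c ∈ M ∧ σ c ≠ f then σ c else τ c)
    else (if σ c = f then π (τ c) else σ c) with hρdef
  have hρ : ∀ c, τ c ∉ W → ρ c ∈ X := by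
    intro c hc
    simp only [hρdef]
    split_ifs with h1 h2 h3
    · exact hX (Finset.mem_erase.2 ⟨h2.2, (hσ c).1⟩)
    · exact hXW _ (hτ c).1 h1 hc
    · exact hX (Finset.mem_erase.2 ⟨h1, hπ _ (hτ c).1⟩)
    · exact hX (Finset.mem_erase.2 ⟨h3, (hσ c).1⟩)
  have hpt : ∀ c, (if τ c ∈ W then 2 * I.d (τ c) c else I.d (ρ c) c) ≤ I.d (σ c) c
      + ((if π (τ c) = f then I.openChange σ τ π M c else 0)
        + if σ c = f then I.closeChange σ τ π c else 0) := by
    intro c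
    have hd := I.d_nonneg (τ c) c
    by_cases hcW : τ c ∈ W
    · obtain ⟨h1, h2⟩ := hW _ hcW
      by_cases h3 : σ c = f <;> simp [hcW, h1, h2, h3, openChange, closeChange]
    · simp only [hρdef, openChange, closeChange, if_neg hcW]
      by_cases h1 : π (τ c) = f <;> by_cases h2 : τ c ∈ M <;> by_cases h3 : σ c = f <;>
        simp [h1, h2, h3, eq_comm (a := f)] <;> linarith
  have h1 := hmove ρ hρ
  have h2 := Finset.sum_le_sum fun c (_ : c ∈ Finset.univ) => hpt c
  rw [Finset.sum_add_distrib, ← I.connCost_eq_sum hσ] at h2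
  have h3 : I.cost S = I.openCost S + I.connCost S := rfl
  linarith

/-- Adding a facility to a local optimum does not pay off, whichever clients `N` would use it. -/
theorem opening_add_nonneg_of_add (hσ : I.IsServing S σ)
    (hadd : ∀ g ∉ S, I.cost S ≤ I.cost (insert g S)) (g : F) (N : Finset C) :
    0 ≤ I.opening g + ∑ c ∈ N, (I.d g c - I.d (σ c) c) := by
  classical
  by_cases hg : g ∈ S
  · exact add_nonneg (I.opening_nonneg g)
      (Finset.sum_nonneg fun c _ => sub_nonneg.2 (hσ.le hg c))
  · have h1 := (hadd g hg).trans (I.cost_le_of_assignment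
      (fun c => if c ∈ N then g else σ c) fun c => by
        split_ifs
        · exact Finset.mem_insert_self _ _
        · exact Finset.mem_insert_of_mem (hσ c).1)
    have h2 : I.openCost (insert g S) = I.opening g + I.openCost S := Finset.sum_insert hg
    have h3 : I.cost S = I.openCost S + ∑ c, I.d (σ c) c := by
      rw [← I.connCost_eq_sum hσ]; rfl
    have h4 : ∑ c, I.d (if c ∈ N then g else σ c) c
        = ∑ c, I.d (σ c) c + ∑ c ∈ N, (I.d g c - I.d (σ c) c) := by
      have h5 : ∑ c ∈ N, (I.d g c - I.d (σ c) c)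
          = ∑ c, if c ∈ N then I.d g c - I.d (σ c) c else 0 := by simp
      rw [h5, ← Finset.sum_add_distrib]
      refine Finset.sum_congr rfl fun c _ => ?_
      split_ifs <;> ring
    linarith

/-- A facility that is its own image under `π` can stay open while the other facilities assigned
to it are added one by one. -/
theorem opening_le_of_self (hσ : I.IsServing S σ) (hτ : I.IsServing T τ)
    (hπ : ∀ g ∈ T, π g ∈ S) (hadd : ∀ g ∉ S, I.cost S ≤ I.cost (insert g S))
    {f : F} (hf : f ∈ S) (hfT : f ∈ T) (hff : π f = f) :
    I.opening f ≤ ∑ g ∈ T with π g = f, I.opening g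
      + ∑ c, ((if π (τ c) = f then I.openChange σ τ π M c else 0)
        + if σ c = f then I.closeChange σ τ π c else 0) := by
  have hclose : ∀ c, 0 ≤ if σ c = f then I.closeChange σ τ π c else 0 := by
    intro c
    unfold closeChange
    split_ifs
    · exact le_rfl
    · exact sub_nonneg.2 (hσ.le (hπ _ (hτ c).1) c)
    · exact le_rfl
  have hopen : ∀ c, (if τ c ∉ M ∨ σ c = π (τ c) then I.d (τ c) c - I.d (σ c) c else 0)
      ≤ I.openChange σ τ π M c := by
    intro c
    have := I.d_nonneg (τ c) c
    unfold openChange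
    by_cases h1 : τ c ∈ M <;> by_cases h2 : σ c = π (τ c) <;> simp [h1, h2] <;> linarith
  have hfG : f ∈ T.filter (π · = f) := Finset.mem_filter.2 ⟨hfT, hff⟩
  have hG : ∀ g ∈ T.filter (π · = f), 0 ≤ (if g = f then 0 else I.opening g)
      + ∑ c with τ c = g, I.openChange σ τ π M c := by
    intro g _
    have hle : ∑ c with τ c = g ∧ (τ c ∉ M ∨ σ c = π (τ c)), (I.d g c - I.d (σ c) c)
        ≤ ∑ c with τ c = g, I.openChange σ τ π M c := by
      rw [← Finset.filter_filter, Finset.sum_filter]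
      refine Finset.sum_le_sum fun c hc => ?_
      rw [← (Finset.mem_filter.1 hc).2]
      exact hopen c
    split_ifs with hgf
    · subst hgf
      rw [zero_add]
      exact le_trans (Finset.sum_nonneg fun c _ => sub_nonneg.2 (hσ.le hf c)) hle
    · exact (opening_add_nonneg_of_add hσ hadd g _).trans (add_le_add le_rfl hle)
  have h1 := Finset.sum_nonneg hG
  rw [Finset.sum_add_distrib, Finset.sum_ite, Finset.sum_const_zero, zero_add] at h1
  have h2 : ∑ g ∈ T.filter (π · = f), ∑ c with τ c = g, I.openChange σ τ π M c
      = ∑ c, if π (τ c) = f then I.openChange σ τ π M c else 0 := by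
    rw [← Finset.sum_filter, ← Finset.sum_fiberwise_of_maps_to (t := T.filter (π · = f)) (g := τ)
      fun c hc => Finset.mem_filter.2 ⟨(hτ c).1, (Finset.mem_filter.1 hc).2⟩]
    refine Finset.sum_congr rfl fun g hg => Finset.sum_congr ?_ fun _ _ => rfl
    ext c
    simp only [Finset.mem_filter, Finset.mem_univ, true_and]
    exact ⟨fun h => ⟨h ▸ (Finset.mem_filter.1 hg).2, h⟩, fun h => h.2⟩
  have h3 : ∑ g ∈ T.filter (π · = f) with ¬ g = f, I.opening g + I.opening f
      = ∑ g ∈ T with π g = f, I.opening g := by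
    rw [Finset.filter_not, Finset.filter_eq', if_pos hfG, Finset.sdiff_singleton_eq_erase]
    exact Finset.sum_erase_add _ _ hfG
  rw [Finset.sum_add_distrib, ← h2]
  have := Finset.sum_nonneg fun c (_ : c ∈ Finset.univ) => hclose c
  linarith

/-- The inequality given by local optimality for the facilities `g` of `T` with `π g = f`, when
they replace `f`. -/
theorem IsLocalOptimum.opening_le [DecidableEq C] [Nonempty C]
    {jms : FacilityLocation F C → Finset F} (hjms : IsJMSAlgorithm jms) {ε : ℝ} (hε : 0 < ε)
    (hS : IsLocalOptimum jms I ε S) (hσ : I.IsServing S σ) (hτ : I.IsServing T τ)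
    (hπ : ∀ g ∈ T, π g ∈ S) (hinj : ∀ g ∈ M, ∀ g' ∈ M, π g = π g' → g = g')
    {f : F} (hf : f ∈ S) :
    I.opening f ≤ ∑ g ∈ T with π g = f, I.opening g
      + ∑ c, ((if π (τ c) = f then I.openChange σ τ π M c else 0)
        + if σ c = f then I.closeChange σ τ π c else 0) := by
  have hε' : (1 : ℝ) ≤ 1 / ε + 1 := by
    have : 0 < 1 / ε := by positivity
    linarith
  have hadd : ∀ g ∉ S, I.cost S ≤ I.cost (insert g S) := by
    intro g hg
    refine hS.swap _ (fun _ => Finset.insert_nonempty _ _) ?_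
    have h1 : insert g S \ S = {g} := by
      rw [Finset.insert_sdiff_of_notMem _ hg, Finset.sdiff_self, insert_empty_eq]
    have h2 : S \ insert g S = ∅ := Finset.sdiff_eq_empty_iff_subset.2 (Finset.subset_insert _ _)
    simpa [h1, h2] using hε'
  by_cases hself : f ∈ T ∧ π f = f
  · exact opening_le_of_self hσ hτ hπ hadd hf hself.1 hself.2
  have hne : ∀ g ∈ T, π g = f → g ≠ f := fun g hg hgf h => hself ⟨h ▸ hg, h ▸ hgf⟩
  by_cases hsub : ∀ g ∈ T, π g = f → g ∈ S
  · refine opening_le_of_move hσ hτ hπ hf (X := S.erase f) (W := ∅) subset_rfl (by simp)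
      (fun g hg hgf _ => Finset.mem_erase.2 ⟨hne g hg hgf, hsub g hg hgf⟩) ?_ fun ρ hρ => ?_
    · have := Finset.sum_nonneg fun g (_ : g ∈ T.filter (π · = f)) => I.opening_nonneg g
      simpa [openCost] using this
    · simp only [Finset.notMem_empty, not_false_eq_true, forall_const] at hρ
      obtain ⟨c⟩ := ‹Nonempty C›
      have h1 : S.erase f \ S = ∅ := Finset.sdiff_eq_empty_iff_subset.2 (Finset.erase_subset _ _)
      have h2 : S \ S.erase f = {f} := by
        ext g
        simp only [Finset.mem_sdiff, Finset.mem_erase, Finset.mem_singleton]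
        constructor
        · rintro ⟨h, h'⟩
          by_contra hgf
          exact h' ⟨hgf, h⟩
        · rintro rfl
          exact ⟨hf, fun h => h.1 rfl⟩
      have h3 := hS.swap (S.erase f) (fun _ => ⟨ρ c, hρ c⟩) (by simpa [h1, h2] using hε')
      simpa [openCost] using h3.trans (I.cost_le_of_assignment ρ hρ)
  · -- A facility of `M`, if it is not open yet, has to be the one that is swapped in directly.
    obtain ⟨g₁, hg₁T, hg₁f, hg₁S, hg₁M⟩ : ∃ g₁ ∈ T, π g₁ = f ∧ g₁ ∉ S ∧
        ∀ g ∈ M, g ∈ T → π g = f → g = g₁ ∨ g ∈ S := by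
      by_cases hM : ∃ g ∈ M, g ∈ T ∧ π g = f ∧ g ∉ S
      · obtain ⟨g₁, h1, h2, h3, h4⟩ := hM
        exact ⟨g₁, h2, h3, h4, fun g hg _ hgf => Or.inl (hinj g hg g₁ h1 (hgf.trans h3.symm))⟩
      · push Not at hsub hM
        obtain ⟨g₁, h1, h2, h3⟩ := hsub
        exact ⟨g₁, h1, h2, h3, fun g hg hgT hgf => Or.inr (hM g hg hgT hgf)⟩
    have hg₁G : g₁ ∈ T.filter (π · = f) := Finset.mem_filter.2 ⟨hg₁T, hg₁f⟩
    refine opening_le_of_move hσ hτ hπ hf (X := insert g₁ (S.erase f))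
      (W := ((T.filter (π · = f)).filter (· ∉ M)).erase g₁) (Finset.subset_insert _ _)
      (fun g hg => ?_) (fun g hg hgf hgW => ?_) ?_ fun ρ hρ => ?_
    · have h1 := Finset.mem_filter.1 (Finset.mem_of_mem_erase hg)
      exact ⟨(Finset.mem_filter.1 h1.1).2, h1.2⟩
    · by_cases hg1 : g = g₁
      · exact hg1 ▸ Finset.mem_insert_self _ _
      · refine Finset.mem_insert_of_mem (Finset.mem_erase.2 ⟨hne g hg hgf, ?_⟩)
        have hgM : g ∈ M := by
          by_contra hgM
          exact hgW (by simp [hg1, hg, hgf, hgM])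
        exact (hg₁M g hgM hg hgf).resolve_left hg1
    · have h1 : I.openCost (insert g₁ (S.erase f)) = I.opening g₁ + I.openCost (S.erase f) :=
        Finset.sum_insert fun h => hg₁S (Finset.mem_of_mem_erase h)
      have h2 : I.openCost (((T.filter (π · = f)).filter (· ∉ M)).erase g₁)
          ≤ ∑ g ∈ (T.filter (π · = f)).erase g₁, I.opening g :=
        Finset.sum_le_sum_of_subset_of_nonneg
          (Finset.erase_subset_erase _ (Finset.filter_subset _ _)) fun g _ _ => I.opening_nonneg g
      have h3 := Finset.sum_erase_add _ I.opening hg₁G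
      linarith
    · exact (hS.extend f hf g₁ hg₁S).trans (cost_extendJMS_le hjms I _ _ τ ρ hρ)

/-! ### Summing over all facilities -/

/-- The clients of `g` that are not served by the partner `f` of `g` are moved to `f`. They are so
few that the distance between `f` and `g`, averaged over the common clients of `f` and `g`, can be
charged to the latter. -/
theorem sum_change_le_of_captures {δ : ℝ} (hδ : 0 < δ) (hδ' : δ ≤ 1 / 2) {f g : F}
    (hcap : Captures (1 - δ) σ τ f g) :
    ∑ c with τ c = g, (if σ c = f then I.d g c - I.d (σ c) c else I.d f c - I.d (σ c) c)
      ≤ ∑ c with τ c = g,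
        (1 / (1 - δ) * I.d g c - I.d (σ c) c + δ / (1 - δ) * I.d (σ c) c) := by
  set N := Finset.univ.filter fun c => τ c = g with hN
  set D := I.facDist f g with hD
  have hD0 : 0 ≤ D := @dist_nonneg _ I.metric _ _
  have hA : Finset.univ.filter (fun c => σ c = f ∧ τ c = g) = N.filter fun c => σ c = f := by
    ext c
    simp [hN, and_comm]
  have hcap' : (1 - δ) * (N.card : ℝ) < ((N.filter fun c => σ c = f).card : ℝ) := by
    rw [← hA]; exact hcap
  have hcard : ((N.filter fun c => σ c = f).card : ℝ) + ((N.filter fun c => ¬ σ c = f).card : ℝ)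
      = N.card := by
    exact_mod_cast Finset.card_filter_add_card_filter_not (s := N) (fun c => σ c = f)
  have hδ1 : 0 < 1 - δ := by linarith
  have hAD : ((N.filter fun c => σ c = f).card : ℝ) * D ≤ ∑ c ∈ N, (I.d (σ c) c + I.d g c) := by
    have h1 : ((N.filter fun c => σ c = f).card : ℝ) * D
        ≤ ∑ c ∈ N.filter (fun c => σ c = f), (I.d (σ c) c + I.d g c) := by
      rw [← nsmul_eq_mul]
      refine Finset.card_nsmul_le_sum _ _ _ fun c hc => ?_
      rw [(Finset.mem_filter.1 hc).2]
      exact I.facDist_le f g c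
    exact h1.trans (Finset.sum_le_sum_of_subset_of_nonneg (Finset.filter_subset _ _)
      fun c _ _ => add_nonneg (I.d_nonneg _ c) (I.d_nonneg _ c))
  have hB : ((N.filter fun c => ¬ σ c = f).card : ℝ) * D
      ≤ δ / (1 - δ) * ∑ c ∈ N, (I.d (σ c) c + I.d g c) := by
    have h1 : ((N.filter fun c => ¬ σ c = f).card : ℝ)
        ≤ δ / (1 - δ) * ((N.filter fun c => σ c = f).card : ℝ) := by
      rw [div_mul_eq_mul_div, le_div_iff₀ hδ1]
      nlinarith
    calc _ ≤ δ / (1 - δ) * ((N.filter fun c => σ c = f).card : ℝ) * D :=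
          mul_le_mul_of_nonneg_right h1 hD0
      _ = δ / (1 - δ) * (((N.filter fun c => σ c = f).card : ℝ) * D) := mul_assoc _ _ _
      _ ≤ _ := mul_le_mul_of_nonneg_left hAD (by positivity)
  have hsplit : ∑ c ∈ N, (if σ c = f then I.d g c - I.d (σ c) c else I.d f c - I.d (σ c) c)
      ≤ ∑ c ∈ N, (I.d g c - I.d (σ c) c) + ((N.filter fun c => ¬ σ c = f).card : ℝ) * D := by
    have : ((N.filter fun c => ¬ σ c = f).card : ℝ) * D = ∑ c ∈ N, if ¬ σ c = f then D else 0 := by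
      rw [← Finset.sum_filter, Finset.sum_const, nsmul_eq_mul]
    rw [this, ← Finset.sum_add_distrib]
    refine Finset.sum_le_sum fun c _ => ?_
    have := I.d_le_facDist_add f g c
    by_cases h : σ c = f <;> simp only [h, if_true, if_false, not_true, not_false_eq_true] <;>
      linarith
  have hcoef : 1 / (1 - δ) = 1 + δ / (1 - δ) := by
    field_simp
    ring
  refine (hsplit.trans (add_le_add le_rfl hB)).trans_eq ?_
  rw [Finset.mul_sum, ← Finset.sum_add_distrib]
  refine Finset.sum_congr rfl fun c _ => ?_
  rw [hcoef]
  ring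

/-- A facility is matched to at most one facility, as it is captured by half by each of them. -/
theorem Matched.right_unique {δ : ℝ} {f g g' : F} (h : Matched δ (1 / 2) σ τ f g)
    (h' : Matched δ (1 / 2) σ τ f g') : g = g' := by
  by_contra hne
  have h1 := h.2
  have h2 := h'.2
  unfold Captures at h1 h2
  have hdisj : Disjoint (Finset.univ.filter fun c => τ c = g ∧ σ c = f)
      (Finset.univ.filter fun c => τ c = g' ∧ σ c = f) :=
    Finset.disjoint_filter.2 fun c _ hc hc' => hne (hc.1.symm.trans hc'.1)
  have h3 := Finset.card_le_card (show (Finset.univ.filter fun c => τ c = g ∧ σ c = f).disjUnion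
      (Finset.univ.filter fun c => τ c = g' ∧ σ c = f) hdisj
      ⊆ Finset.univ.filter fun c => σ c = f by
    intro c hc
    simp only [Finset.mem_disjUnion, Finset.mem_filter, Finset.mem_univ, true_and] at hc ⊢
    exact hc.elim And.right And.right)
  rw [Finset.card_disjUnion] at h3
  have h4 : ((Finset.univ.filter fun c => τ c = g ∧ σ c = f).card : ℝ)
      + ((Finset.univ.filter fun c => τ c = g' ∧ σ c = f).card : ℝ)
      ≤ (Finset.univ.filter fun c => σ c = f).card := by exact_mod_cast h3
  linarith

/-- Each matched facility of `T` is assigned to its partner in `S`, each lonely one to a nearest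
facility of `S`. -/
theorem exists_assignment (I : FacilityLocation F C) (δ : ℝ) (hS : S.Nonempty) :
    ∃ π : F → F, (∀ g ∈ T, π g ∈ S) ∧
      (∀ g ∈ matchedPart δ (1 / 2) S T σ τ, Matched δ (1 / 2) σ τ (π g) g) ∧
      ∀ g ∈ T, g ∉ matchedPart δ (1 / 2) S T σ τ →
        ∀ f ∈ S, I.facDist (π g) g ≤ I.facDist f g := by
  have : ∀ g, ∃ f ∈ S, (g ∈ matchedPart δ (1 / 2) S T σ τ → Matched δ (1 / 2) σ τ f g) ∧
      (g ∉ matchedPart δ (1 / 2) S T σ τ → ∀ f' ∈ S, I.facDist f g ≤ I.facDist f' g) := by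
    intro g
    by_cases hg : g ∈ matchedPart δ (1 / 2) S T σ τ
    · have hg' := hg
      simp only [matchedPart, Finset.mem_filter] at hg'
      obtain ⟨-, f, hf, hm⟩ := hg'
      exact ⟨f, hf, fun _ => hm, fun h => absurd hg h⟩
    · obtain ⟨f, hf, hmin⟩ := S.exists_min_image (fun f => I.facDist f g) hS
      exact ⟨f, hf, fun h => absurd h hg, fun _ => hmin⟩
  choose π h1 h2 h3 using this
  exact ⟨π, fun g _ => h1 g, fun g hg => h2 g hg, fun g _ hg => h3 g hg⟩

/-- The approximation guarantee of local optima, without any error term. -/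
theorem IsLocalOptimum.cost_le [DecidableEq C] [Nonempty C]
    {jms : FacilityLocation F C → Finset F} (hjms : IsJMSAlgorithm jms) {ε δ : ℝ} (hε : 0 < ε)
    (hδ : 0 < δ) (hδ' : δ ≤ 1 / 2) (hS : IsLocalOptimum jms I ε S) (hσ : I.IsServing S σ)
    (hτ : I.IsServing T τ) :
    I.openCost S + I.connCost S ≤ I.openCost T + δ / (1 - δ) * I.connCost S
      + 1 / (1 - δ) * I.servedCost τ (matchedPart δ (1 / 2) S T σ τ)
      + 4 * I.servedCost τ (lonelyPart δ (1 / 2) S T σ τ) := by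
  set M := matchedPart δ (1 / 2) S T σ τ with hM
  obtain ⟨π, hπ, hmatch, hnear⟩ := exists_assignment (S := S) (T := T) (σ := σ) (τ := τ) I δ
    (hS.isSolution ‹_›)
  have hinj : ∀ g ∈ M, ∀ g' ∈ M, π g = π g' → g = g' := fun g hg g' hg' h =>
    (hmatch g hg).right_unique (h ▸ hmatch g' hg')
  -- Each client is involved when `π (τ c)` is closed and when `σ c` is closed.
  have hsum : I.openCost S ≤ I.openCost T
      + ∑ c, (I.openChange σ τ π M c + I.closeChange σ τ π c) := by
    have h1 := Finset.sum_le_sum fun f (hf : f ∈ S) =>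
      hS.opening_le hjms hε hσ hτ hπ hinj hf
    rw [Finset.sum_add_distrib, Finset.sum_fiberwise_of_maps_to hπ, Finset.sum_comm] at h1
    refine h1.trans_eq (congrArg _ (Finset.sum_congr rfl fun c _ => ?_))
    rw [Finset.sum_add_distrib, Finset.sum_ite_eq, Finset.sum_ite_eq, if_pos (hπ _ (hτ c).1),
      if_pos (hσ c).1]
  have hδ0 : 0 ≤ δ / (1 - δ) := div_nonneg hδ.le (by linarith)
  have hmatched : ∑ c with τ c ∈ M, (I.openChange σ τ π M c + I.closeChange σ τ π c)
      ≤ ∑ c with τ c ∈ M,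
        (1 / (1 - δ) * I.d (τ c) c - I.d (σ c) c + δ / (1 - δ) * I.d (σ c) c) := by
    rw [← Finset.sum_fiberwise_of_maps_to (t := M) (g := τ)
        (fun c hc => (Finset.mem_filter.1 hc).2),
      ← Finset.sum_fiberwise_of_maps_to (t := M) (g := τ)
        (fun c hc => (Finset.mem_filter.1 hc).2)
        (fun c => 1 / (1 - δ) * I.d (τ c) c - I.d (σ c) c + δ / (1 - δ) * I.d (σ c) c)]
    refine Finset.sum_le_sum fun g hg => ?_
    have hfib : (Finset.univ.filter fun c => τ c ∈ M).filter (fun c => τ c = g)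
        = Finset.univ.filter fun c => τ c = g := by
      ext c
      simp only [Finset.mem_filter, Finset.mem_univ, true_and]
      exact ⟨And.right, fun h => ⟨h ▸ hg, h⟩⟩
    rw [hfib]
    refine le_trans (le_of_eq ?_) ((sum_change_le_of_captures (I := I) hδ hδ'
      (hmatch g hg).1).trans (le_of_eq ?_)) <;> refine Finset.sum_congr rfl fun c hc => ?_
    · obtain rfl := (Finset.mem_filter.1 hc).2
      unfold openChange closeChange
      rw [if_pos hg]
      split_ifs <;> ring
    · obtain rfl := (Finset.mem_filter.1 hc).2
      rfl
  have hlonely : ∑ c with τ c ∉ M, (I.openChange σ τ π M c + I.closeChange σ τ π c)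
      ≤ ∑ c with τ c ∉ M, (4 * I.d (τ c) c - I.d (σ c) c + δ / (1 - δ) * I.d (σ c) c) := by
    refine Finset.sum_le_sum fun c hc => ?_
    have hc' := (Finset.mem_filter.1 hc).2
    have h1 := openChange_add_closeChange_le hc'
      (hnear (τ c) (hτ c).1 hc' (σ c) (hσ c).1)
    have h2 := mul_nonneg hδ0 (I.d_nonneg (σ c) c)
    linarith
  have hML : Finset.univ.filter (fun c => τ c ∈ lonelyPart δ (1 / 2) S T σ τ)
      = Finset.univ.filter fun c => τ c ∉ M := by
    ext c
    simp [lonelyPart, hM, (hτ c).1]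
  have e1 := Finset.sum_filter_add_sum_filter_not Finset.univ (fun c => τ c ∈ M)
    fun c => I.openChange σ τ π M c + I.closeChange σ τ π c
  have e2 := Finset.sum_filter_add_sum_filter_not Finset.univ (fun c => τ c ∈ M)
    fun c => I.d (σ c) c
  rw [← I.connCost_eq_sum hσ] at e2
  simp only [Finset.sum_add_distrib, Finset.sum_sub_distrib, ← Finset.mul_sum] at hmatched hlonely
  simp only [Finset.sum_add_distrib] at e1 hsum
  unfold servedCost
  rw [hML]
  have e3 := congrArg (δ / (1 - δ) * ·) e2
  simp only [mul_add] at e3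
  linarith

end Moves

/-- Without clients, local optimality forces the opened facilities to be free. -/
theorem IsLocalOptimum.openCost_le_zero [Fintype C] [DecidableEq F] [IsEmpty C]
    {jms : FacilityLocation F C → Finset F} {I : FacilityLocation F C} {ε : ℝ} (hε : 0 < ε)
    {S : Finset F} (hS : IsLocalOptimum jms I ε S) : I.openCost S ≤ 0 := by
  refine Finset.sum_nonpos fun f hf => ?_
  have hε' : 0 < 1 / ε := by positivity
  have h1 : S.erase f \ S = ∅ := Finset.sdiff_eq_empty_iff_subset.2 (Finset.erase_subset _ _)
  have h2 : (S \ S.erase f).card = 1 := by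
    rw [Finset.card_sdiff_of_subset (Finset.erase_subset _ _), Finset.card_erase_of_mem hf]
    have := Finset.card_pos.2 ⟨f, hf⟩
    omega
  have h3 := hS.swap (S.erase f) (fun h => isEmptyElim h.some) (by
    rw [h1, h2]; simpa using hε'.le)
  have h4 := Finset.sum_erase_add S I.opening hf
  simp only [cost, connCost, openCost, Finset.univ_eq_empty, Finset.sum_empty] at h3
  linarith

end FacilityLocation

theorem mainTheorem7 :
    ∃ K : ℝ, ∀ (F C : Type*) [Fintype F] [DecidableEq F] [Fintype C] [DecidableEq C]
      (jms : FacilityLocation F C → Finset F) (_hjms : FacilityLocation.IsJMSAlgorithm jms)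
      (I : FacilityLocation F C) (ε δ : ℝ) (_hε : 0 < ε) (_hδ : 0 < δ) (_hδ' : δ ≤ 1 / 2)
      (S OPT : Finset F) (_hS : FacilityLocation.IsLocalOptimum jms I ε S)
      (_hOPT : I.IsSolution OPT) (σ τ : C → F)
      (_hσ : I.IsServing S σ) (_hτ : I.IsServing OPT τ),
      I.openCost S + I.connCost S ≤
        I.openCost OPT + δ / (1 - δ) * I.connCost S
          + 1 / (1 - δ) *
            I.servedCost τ (FacilityLocation.matchedPart δ (1 / 2) S OPT σ τ)
          + 4 * I.servedCost τ (FacilityLocation.lonelyPart δ (1 / 2) S OPT σ τ)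
          + K * (ε * (I.connCost S + I.connCost OPT)) := by
  -- Moves that close one facility and open one directly are enough, so no error term is needed.
  refine ⟨0, ?_⟩
  intro F C _ _ _ _ jms hjms I ε δ hε hδ hδ' S OPT hS _ σ τ hσ hτ
  rw [zero_mul, add_zero]
  cases isEmpty_or_nonempty C
  · have h1 := hS.openCost_le_zero hε
    have h2 : 0 ≤ I.openCost OPT := Finset.sum_nonneg fun f _ => I.opening_nonneg f
    simp only [FacilityLocation.connCost, FacilityLocation.servedCost, Finset.univ_eq_empty,
      Finset.filter_empty, Finset.sum_empty]
    linarith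
  · exact hS.cost_le hjms hε hδ hδ' hσ hτ
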